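/- **Conventions.** $\mathbb{R}^d$ carries the coordinatewise partial order: $s\le t$ iff $s_i\le t_i$ for all $i$. For random vectors $Z\in\mathbb{R}^q$ and $Y\in\mathbb{R}^r$ on the same probability space, a *version of* $y\mapsto\mathcal{L}(Z\mid Y=y)$ is a Markov kernel $\kappa$ from $\mathbb{R}^r$ to $\mathbb{R}^q$ with $\mathbb{P}(Z\in A,\,Y\in B)=\int_B\kappa(y)(A)\,\mathcal{L}(Y)(dy)$ for all Borel sets $A\subseteq\mathbb{R}^q$, $B\subseteq\mathbb{R}^r$. Let $S\subseteq\mathbb{R}^r$ be such that $Y\in S$ almost surely. We say that $Z$ is *stochastically increasing with respect to $Y$ over $S$, with version $\kappa$*, if $\kappa(y_1)\{z: z\le x\}\ge\kappa(y_2)\{z: z\le x\}$ for all $x\in\mathbb{R}^q$ and all $y_1\le y_2$ in $S$; *stochastically decreasing* if $-Z$ is stochastically increasing with respect to $Y$ over $S$, with the image of $\kappa$ under $z\mapsto -z$ as version; *stochastically monotone* if it is one of the two. (One may take $S=\mathbb{R}^r$ or, if $Y$ is discrete, $S=\{y:\mathbb{P}(Y=y)>0\}$.) Convergence in distribution is denoted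 by $\xrightarrow{d}$, and limits are as $n\to\infty$. **Corollary 2.5.** Let $q,r\ge1$, let $T$ be an invertible linear operator on $\mathbb{R}^q$, and let $(X_n,Y_n)$ be pairs of random vectors, $X_n\in\mathbb{R}^q$, $Y_n\in\mathbb{R}^r$ (for different $n$ possibly on different probability spaces). For every $n$ let $\kappa_n$ be a version of $y\mapsto\mathcal{L}(X_n\mid Y_n=y)$ and $S_n\subseteq\mathbb{R}^r$ a set with $\mathbb{P}(Y_n\in S_n)=1$, such that $TX_n$ is stochastically monotone with respect to $Y_n$ over $S_n$, with the image of $\kappa_n$ under $T$ as version. Let $a_n>0$, $c_n>0$, $b_n\in\mathbb{R}^q$, $d_n\in\mathbb{R}^r$ be such that $$\bigl(a_n^{-1}(X_n-b_n),\,c_n^{-1}(Y_n-d_n)\bigr)\xrightarrow{d}(X,Y)$$ for a pair of random vectors $X\in\mathbb{R}^q$, $Y\in\mathbb{R}^r$. Let $y_n\in S_n$ be such that $c_n^{-1}(y_n-d_n)\to\xi$ for some $\xi\in\mathbb{R}^r$, and let $\tilde X_n$ be a random vector with distribution $\mathcal{L}(X_n\mid Y_n=y_n):=\kappa_n(y_n)$.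 1. Suppose that $\xi$ is an interior point of the support of $\mathcal{L}(Y)$ and that $\kappa$ is a version of $y\mapsto\mathcal{L}(X\mid Y=y)$ that is continuous at $y=\xi$ as a map from $\mathbb{R}^r$ into the space of probability measures on $\mathbb{R}^q$ with the weak topology. Then $$a_n^{-1}(\tilde X_n-b_n)\xrightarrow{d}\mathcal{L}(X\mid Y=\xi):=\kappa(\xi).$$ 2. Suppose that $r=1$ and that $(X,Y)$ is (jointly) normal with $\operatorname{Var}(Y)>0$. Let $\gamma=(\gamma^{(1)},\dots,\gamma^{(q)})$ with $\gamma^{(i)}=\operatorname{Cov}(X^{(i)},Y)/\operatorname{Var}(Y)$. Then $$a_n^{-1}(\tilde X_n-b_n)\xrightarrow{d}\tilde X:=X+(\xi-Y)\gamma,$$ and $\tilde X$ is normal with $\mathbb{E}\tilde X=\mathbb{E}X+(\xi-\mathbb{E}Y)\gamma$ and $$\operatorname{Cov}(\tilde X^{(i)},\tilde X^{(j)})=\operatorname{Cov}(X^{(i)},X^{(j)})-\frac{\operatorname{Cov}(X^{(i)},Y)\operatorname{Cov}(X^{(j)},Y)}{\operatorname{Var}(Y)}\qquad(1\le i,j\le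 q).$$ -/

import Mathlib

open MeasureTheory ProbabilityTheory Filter Topology

/-- A family `y ↦ m y` of measures on a partially ordered space is stochastically increasing over
the set `S` of parameters: `m y₁ {z | z ≤ x} ≥ m y₂ {z | z ≤ x}` for all `x` and all `y₁ ≤ y₂`
in `S`. On `Fin d → ℝ` the order is the coordinatewise one. -/
def StochIncreasingOn {E F : Type*} [MeasurableSpace E] [Preorder E] [Preorder F]
    (m : F → Measure E) (S : Set F) : Prop :=
  ∀ x : E, ∀ y₁ ∈ S, ∀ y₂ ∈ S, y₁ ≤ y₂ → m y₂ (Set.Iic x) ≤ m y₁ (Set.Iic x)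

/-- The random variable `X` is stochastically increasing with respect to `Y`, with the kernel `κ` as
the witnessing version of `y ↦ L(X | Y = y)`, considered for `y` in the set `S` only, where
`Y ∈ S` almost surely. One may take `S = Set.univ`, or, when `Y` is discrete, the set of the values
`y` with `P (Y = y) > 0`. -/
structure StochIncreasingWrt {Ω E F : Type*} [MeasurableSpace Ω] [MeasurableSpace E]
    [MeasurableSpace F] [Preorder E] [Preorder F]
    (X : Ω → E) (Y : Ω → F) (P : Measure Ω) (κ : Kernel F E) (S : Set F) : Prop where
  hasCondDistrib : HasCondDistrib X Y κ P
  ae_mem : ∀ᵐ y ∂(P.map Y), y ∈ S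
  increasing : StochIncreasingOn κ S

/-- `X` is stochastically decreasing with respect to `Y`: `-X` is stochastically increasing; the
version of `y ↦ L(-X | Y = y)` is the image of `κ` under `x ↦ -x`. -/
def StochDecreasingWrt {Ω E F : Type*} [MeasurableSpace Ω] [MeasurableSpace E]
    [MeasurableSpace F] [Preorder E] [Preorder F] [Neg E]
    (X : Ω → E) (Y : Ω → F) (P : Measure Ω) (κ : Kernel F E) (S : Set F) : Prop :=
  StochIncreasingWrt (fun ω ↦ -X ω) Y P (κ.map fun x ↦ -x) S

/-- `X` is stochastically monotone with respect to `Y`. -/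
def StochMonotoneWrt {Ω E F : Type*} [MeasurableSpace Ω] [MeasurableSpace E]
    [MeasurableSpace F] [Preorder E] [Preorder F] [Neg E]
    (X : Ω → E) (Y : Ω → F) (P : Measure Ω) (κ : Kernel F E) (S : Set F) : Prop :=
  StochIncreasingWrt X Y P κ S ∨ StochDecreasingWrt X Y P κ S

/-- A Markov kernel as a map into the space of probability measures (with the weak topology). -/
def kernelLaw {E F : Type*} [MeasurableSpace E] [MeasurableSpace F]
    (κ : Kernel F E) [IsMarkovKernel κ] (y : F) : ProbabilityMeasure E :=
  ⟨κ y, inferInstance⟩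

/-!
The idea is to sandwich the conditional law at the single parameter `y n`, a value which `Y n` may
take with probability zero, between averages of conditional laws over parameters above and below
it. Such averages are weakly continuous functionals of the joint law of the normalised pair.

Write `ξ` for the limit of the normalised parameters, and let `w₀` be close to `ξ` and in the
support of the limiting `Y`. Weighting a test function `g` of the first coordinate with a bump
function of the second one around `w₀`, and using that the limiting conditional laws are continuous
at `ξ`, one finds parameters near `w₀` at which `g` has conditional expectation almost at least
`∫ g dκ'(ξ)` (`eventually_nhds_exists_lt_integral`; apply it to `-g` for the reverse inequality).
Taking `w₀` strictly above or strictly below `ξ` in every coordinate, such parameters are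
comparable with `y n`, and for stochastically increasing laws the two comparisons bound the
distribution function at `y n` from both sides by that of `κ' ξ` at slightly shifted points
(`tendsto_kernelLaw_of_stochIncreasingOn`). Such a sandwich implies weak convergence
(`tendsto_probabilityMeasure_of_Iic_sandwich`). The decreasing case follows by reflection, and a
sequence of mixed type is treated along the two sets of indices separately
(`tendsto_kernelLaw_map_of_stochMonotoneWrt`). The parameter space is an ordered normed space
whose positive cone has interior, which covers both `Fin r → ℝ` and `ℝ`.

In the Gaussian case the residual `X - Y γ` is uncorrelated with `Y`, hence independent of it, so the
translates of its law by `y γ` form a weakly continuous version of the conditional law of `X` given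
`Y = y`; the support of `Y` is the whole line, so the general result applies at every `ξ`.
-/

/-! ### Weak convergence from distribution functions -/

/-- Lower bounds on finitely many coordinates are imposed on a lower orthant one at a time, each of
them removing a set of the same kind with one coordinate of the corner lowered. -/
theorem tendsto_measureReal_lowerOrthant_inter {ι α : Type*} [Fintype ι]
    {l : Filter α} {μ : α → ProbabilityMeasure (ι → ℝ)} {ν : ProbabilityMeasure (ι → ℝ)}
    {D : ι → Set ℝ}
    (h : ∀ x : ι → ℝ, (∀ i, x i ∈ D i) →
      Tendsto (fun n ↦ (μ n : Measure (ι → ℝ)).real (Set.Iic x)) l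
        (𝓝 ((ν : Measure (ι → ℝ)).real (Set.Iic x))))
    {a : ι → ℝ} (ha : ∀ i, a i ∈ D i) (J : Finset ι) :
    ∀ b : ι → ℝ, (∀ i, b i ∈ D i) → (∀ i, a i ≤ b i) →
      Tendsto (fun n ↦ (μ n : Measure (ι → ℝ)).real (Set.Iic b ∩ {z | ∀ i ∈ J, a i < z i})) l
        (𝓝 ((ν : Measure (ι → ℝ)).real (Set.Iic b ∩ {z | ∀ i ∈ J, a i < z i}))) := by
  classical
  induction J using Finset.induction_on with
  | empty => intro b hb _; simpa using h b hb
  | insert j J hj ih =>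
    intro b hb hab
    set b' := Function.update b j (a j) with hb'
    have hb'D : ∀ i, b' i ∈ D i := by
      intro i
      rcases eq_or_ne i j with rfl | hij
      · simpa [hb'] using ha i
      · simpa [hb', hij] using hb i
    have hab' : ∀ i, a i ≤ b' i := by
      intro i
      rcases eq_or_ne i j with rfl | hij
      · simp [hb']
      · simpa [hb', hij] using hab i
    have hb'b : b' ≤ b := by
      intro i
      rcases eq_or_ne i j with rfl | hij
      · simpa [hb'] using hab i
      · simp [hb', hij]
    have hdiff : Set.Iic b ∩ {z | ∀ i ∈ insert j J, a i < z i} =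
        (Set.Iic b ∩ {z | ∀ i ∈ J, a i < z i}) \ (Set.Iic b' ∩ {z | ∀ i ∈ J, a i < z i}) := by
      ext z
      simp only [Finset.forall_mem_insert, Set.mem_inter_iff, Set.mem_Iic, Set.mem_ofPred_eq,
        Set.mem_sdiff, not_and]
      constructor
      · rintro ⟨hz, hj', hJ⟩
        refine ⟨⟨hz, hJ⟩, fun hz' ↦ ?_⟩
        have := hz' j
        simp [hb'] at this
        linarith
      · rintro ⟨⟨hz, hJ⟩, hn⟩
        refine ⟨hz, ?_, hJ⟩
        by_contra! hc
        refine hn (fun i ↦ ?_) hJ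
        rcases eq_or_ne i j with rfl | hij
        · simpa [hb'] using hc
        · simpa [hb', hij] using hz i
    have hm : MeasurableSet (Set.Iic b' ∩ {z : ι → ℝ | ∀ i ∈ J, a i < z i}) := by
      refine measurableSet_Iic.inter ?_
      have : {z : ι → ℝ | ∀ i ∈ J, a i < z i} = ⋂ i ∈ J, {z | a i < z i} := by ext; simp
      rw [this]
      exact Finset.measurableSet_biInter _ fun i _ ↦
        measurableSet_lt measurable_const (measurable_pi_apply i)
    have hsub : (Set.Iic b' ∩ {z : ι → ℝ | ∀ i ∈ J, a i < z i}) ⊆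
        Set.Iic b ∩ {z | ∀ i ∈ J, a i < z i} :=
      Set.inter_subset_inter_left _ (Set.Iic_subset_Iic.2 hb'b)
    have key (ρ : ProbabilityMeasure (ι → ℝ)) := measureReal_sdiff (μ := (ρ : Measure _)) hsub hm
    simp_rw [hdiff, key]
    exact (ih b hb hab).sub (ih b' hb'D hab')

/-- Weak convergence on `ℝ^ι` follows from the convergence of the distribution functions at the
points all of whose coordinates avoid fixed negligible sets: half-open boxes form a π-system, and
their probabilities are alternating sums of values of the distribution function. -/
theorem tendsto_probabilityMeasure_of_tendsto_Iic {ι α : Type*} [Fintype ι]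
    {l : Filter α} [l.IsCountablyGenerated]
    {μ : α → ProbabilityMeasure (ι → ℝ)} {ν : ProbabilityMeasure (ι → ℝ)}
    {D : ι → Set ℝ} (hD : ∀ i, Dense (D i))
    (h : ∀ x : ι → ℝ, (∀ i, x i ∈ D i) →
      Tendsto (fun n ↦ (μ n : Measure (ι → ℝ)).real (Set.Iic x)) l
        (𝓝 ((ν : Measure (ι → ℝ)).real (Set.Iic x)))) :
    Tendsto μ l (𝓝 ν) := by
  let S : Set (Set (ι → ℝ)) := {s | ∃ a b : ι → ℝ, (∀ i, a i ∈ D i) ∧ (∀ i, b i ∈ D i) ∧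
    (∀ i, a i ≤ b i) ∧ s = Set.univ.pi fun i ↦ Set.Ioc (a i) (b i)}
  have hS : IsPiSystem S := by
    rintro _ ⟨a, b, ha, hb, -, rfl⟩ _ ⟨a', b', ha', hb', -, rfl⟩ ⟨z, hz, hz'⟩
    refine ⟨a ⊔ a', b ⊓ b', fun i ↦ ?_, fun i ↦ ?_, fun i ↦ ?_, ?_⟩
    · rcases max_choice (a i) (a' i) with h | h <;> simp [h, ha, ha']
    · rcases min_choice (b i) (b' i) with h | h <;> simp [h, hb, hb']
    · have h1 := hz i trivial
      have h2 := hz' i trivial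
      exact ((max_lt h1.1 h2.1).trans_le (le_min h1.2 h2.2)).le
    · rw [← Set.pi_inter_distrib]
      simp [Set.Ioc_inter_Ioc]
  refine hS.tendsto_probabilityMeasure_of_tendsto_of_mem ?_ ?_ ?_
  · rintro _ ⟨a, b, -, -, -, rfl⟩
    exact MeasurableSet.univ_pi fun i ↦ measurableSet_Ioc
  · intro u hu x hx
    obtain ⟨ε, hε, hball⟩ := Metric.isOpen_iff.1 hu x hx
    choose a haD ha using fun i ↦ (hD i).exists_between (show x i - ε < x i by linarith)
    choose b hbD hb using fun i ↦ (hD i).exists_between (show x i < x i + ε by linarith)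
    refine ⟨_, ⟨a, b, haD, hbD, fun i ↦ ((ha i).2.trans (hb i).1).le, rfl⟩, ?_, ?_⟩
    · exact set_pi_mem_nhds Set.finite_univ fun i _ ↦ Ioc_mem_nhds (ha i).2 (hb i).1
    · intro z hz
      refine hball ?_
      rw [Metric.mem_ball, dist_pi_lt_iff hε]
      intro i
      have := hz i trivial
      rw [Real.dist_eq, abs_lt]
      constructor <;> linarith [this.1, this.2, (ha i).1, (hb i).2]
  · rintro _ ⟨a, b, ha, hb, hab, rfl⟩
    have heq : (Set.univ.pi fun i ↦ Set.Ioc (a i) (b i)) =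
        Set.Iic b ∩ {z | ∀ i ∈ Finset.univ, a i < z i} := by
      ext z
      simp [Set.mem_pi, Pi.le_def, forall_and, and_comm]
    have := tendsto_measureReal_lowerOrthant_inter h ha Finset.univ b hb hab
    rw [heq]
    rw [← NNReal.tendsto_coe]
    exact this

/-- Weak convergence on `ℝ^ι` from a sandwich of the Lévy type between the distribution functions:
at points whose coordinates are not atoms of the marginals of `ν`, it forces the convergence of the
distribution functions. -/
theorem tendsto_probabilityMeasure_of_Iic_sandwich {ι α : Type*} [Fintype ι]
    {l : Filter α} [l.IsCountablyGenerated]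
    {μ : α → ProbabilityMeasure (ι → ℝ)} {ν : ProbabilityMeasure (ι → ℝ)}
    (hle : ∀ x : ι → ℝ, ∀ δ > (0 : ℝ), ∀ ε > (0 : ℝ), ∀ᶠ n in l,
      (μ n : Measure (ι → ℝ)).real (Set.Iic x)
        ≤ (ν : Measure (ι → ℝ)).real (Set.Iic (x + fun _ ↦ δ)) + ε)
    (hge : ∀ x : ι → ℝ, ∀ δ > (0 : ℝ), ∀ ε > (0 : ℝ), ∀ᶠ n in l,
      (ν : Measure (ι → ℝ)).real (Set.Iic (x - fun _ ↦ δ)) - ε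
        ≤ (μ n : Measure (ι → ℝ)).real (Set.Iic x)) :
    Tendsto μ l (𝓝 ν) := by
  let D : ι → Set ℝ := fun i ↦ {t | 0 < (ν : Measure (ι → ℝ)) {z | z i = t}}ᶜ
  have hD : ∀ i, Dense (D i) := fun i ↦
    (Measure.countable_meas_level_set_pos (μ := (ν : Measure (ι → ℝ))) (g := fun z ↦ z i)
      (measurable_pi_apply i)).dense_compl ℝ
  refine tendsto_probabilityMeasure_of_tendsto_Iic hD fun x hx ↦ ?_
  obtain ⟨u, hu_anti, hu_pos, hu⟩ := exists_seq_strictAnti_tendsto (0 : ℝ)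
  have hup : Tendsto (fun k ↦ (ν : Measure (ι → ℝ)).real (Set.Iic (x + fun _ ↦ u k))) atTop
      (𝓝 ((ν : Measure (ι → ℝ)).real (Set.Iic x))) := by
    have hinter : Set.Iic x = ⋂ k, Set.Iic (x + fun _ ↦ u k) := by
      ext z
      simp only [Set.mem_Iic, Set.mem_iInter]
      refine ⟨fun hz k ↦ hz.trans fun i ↦ ?_, fun hz i ↦ ?_⟩
      · simpa using (hu_pos k).le
      · refine ge_of_tendsto' (f := fun k ↦ x i + u k) (x := atTop) ?_ fun k ↦ hz k i
        simpa using hu.const_add (x i)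
    rw [hinter]
    refine (ENNReal.tendsto_toReal (measure_ne_top _ _)).comp
      (tendsto_measure_iInter_atTop (fun k ↦ measurableSet_Iic.nullMeasurableSet) ?_
        ⟨0, measure_ne_top _ _⟩)
    intro k m hkm
    refine Set.Iic_subset_Iic.2 fun i ↦ ?_
    simpa using hu_anti.antitone hkm
  have hdown : Tendsto (fun k ↦ (ν : Measure (ι → ℝ)).real (Set.Iic (x - fun _ ↦ u k))) atTop
      (𝓝 ((ν : Measure (ι → ℝ)).real (Set.Iic x))) := by
    have hunion : (ν : Measure (ι → ℝ)) (Set.Iic x) =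
        (ν : Measure (ι → ℝ)) (⋃ k, Set.Iic (x - fun _ ↦ u k)) := by
      refine le_antisymm ?_ (measure_mono (Set.iUnion_subset fun k ↦ Set.Iic_subset_Iic.2
        fun i ↦ by simpa using (hu_pos k).le))
      have hnull : (ν : Measure (ι → ℝ)) (⋃ i, {z | z i = x i}) = 0 :=
        measure_iUnion_null fun i ↦ by simpa [D] using hx i
      refine (measure_mono ?_).trans ((measure_union_le
        (⋃ k, Set.Iic (x - fun _ ↦ u k)) (⋃ i, {z | z i = x i})).trans_eq
        (by rw [hnull, add_zero]))
      intro z hz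
      by_cases hc : ∃ i, z i = x i
      · exact Or.inr (by simpa using hc)
      · push Not at hc
        refine Or.inl (Set.mem_iUnion.2 ?_)
        have hev : ∀ᶠ k in atTop, ∀ i, u k < x i - z i :=
          eventually_all.2 fun i ↦ (tendsto_order.1 hu).2 _
            (sub_pos.2 (lt_of_le_of_ne (hz i) (hc i)))
        obtain ⟨k, hk⟩ := hev.exists
        refine ⟨k, fun i ↦ ?_⟩
        have := hk i
        simp only [Pi.sub_apply]
        linarith
    rw [measureReal_def, hunion]
    refine (ENNReal.tendsto_toReal (measure_ne_top _ _)).comp (tendsto_measure_iUnion_atTop ?_)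
    intro k m hkm
    refine Set.Iic_subset_Iic.2 (sub_le_sub_left (fun i ↦ ?_) x)
    exact hu_anti.antitone hkm
  refine tendsto_order.2 ⟨fun r hr ↦ ?_, fun r hr ↦ ?_⟩
  · obtain ⟨k, hk⟩ := ((tendsto_order.1 hdown).1 r hr).exists
    filter_upwards [hge x (u k) (hu_pos k) _ (half_pos (sub_pos.2 hk))] with n hn
    linarith
  · obtain ⟨k, hk⟩ := ((tendsto_order.1 hup).2 r hr).exists
    filter_upwards [hle x (u k) (hu_pos k) _ (half_pos (sub_pos.2 hk))] with n hn
    linarith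

/-! ### Localisation and monotone comparison -/

theorem integral_mul_eq_of_hasCondDistrib {Ω E F : Type*} [MeasurableSpace Ω]
    [TopologicalSpace E] [MeasurableSpace E] [OpensMeasurableSpace E]
    [TopologicalSpace F] [MeasurableSpace F] [OpensMeasurableSpace F]
    {P : Measure Ω} [IsProbabilityMeasure P] {U : Ω → E} {W : Ω → F}
    {κ : Kernel F E} [IsMarkovKernel κ] (h : HasCondDistrib U W κ P)
    (g : BoundedContinuousFunction E ℝ) (φ : BoundedContinuousFunction F ℝ) :
    Integrable (fun w ↦ (∫ z, g z ∂κ w) * φ w) (P.map W) ∧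
      ∫ ω, g (U ω) * φ (W ω) ∂P = ∫ w, (∫ z, g z ∂κ w) * φ w ∂(P.map W) := by
  have hW : AEMeasurable W P := h.aemeasurable_fst
  have := Measure.isProbabilityMeasure_map (μ := P) hW
  have hmeas : Measurable fun p : F × E ↦ g p.2 * φ p.1 :=
    (g.continuous.measurable.comp measurable_snd).mul (φ.continuous.measurable.comp measurable_fst)
  have hint : Integrable (fun p : F × E ↦ g p.2 * φ p.1) ((P.map W) ⊗ₘ κ) := by
    refine Integrable.of_bound hmeas.aestronglyMeasurable (‖g‖ * ‖φ‖) (ae_of_all _ fun p ↦ ?_)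
    rw [norm_mul]
    gcongr
    · exact g.norm_coe_le_norm _
    · exact φ.norm_coe_le_norm _
  have hmul (w : F) : ∫ z, g z * φ w ∂κ w = (∫ z, g z ∂κ w) * φ w := integral_mul_const _ _
  constructor
  · simpa only [hmul, Kernel.prodMkLeft_apply, Kernel.const_apply] using hint.integral_compProd
  · have h1 := integral_map (μ := P) h.aemeasurable (f := fun p : F × E ↦ g p.2 * φ p.1)
      (hmeas.aestronglyMeasurable)
    rw [h.map_eq, Measure.integral_compProd hint] at h1
    simpa only [hmul] using h1.symm

/-- Localisation of convergence in distribution. If `(U n, W n)` converges in distribution to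
`(U, W)` and `κ'` is a version of the conditional law of `U` given `W` that is continuous at `ξ`,
then, for a bounded continuous `g` with positive expectation under `κ' ξ`, every neighbourhood of a
point of the support of `W` close to `ξ` eventually contains parameters, in prescribed almost sure
sets, for which the conditional expectation of `g (U n)` is positive. The proof weights `g (U n)`
with a bump function of `W n`. -/
theorem eventually_nhds_exists_integral_pos {α E F : Type*}
    [TopologicalSpace E] [SecondCountableTopology E] [MeasurableSpace E] [BorelSpace E]
    [PseudoMetricSpace F] [SecondCountableTopology F] [MeasurableSpace F] [BorelSpace F]
    {Ω : α → Type*} [∀ n, MeasurableSpace (Ω n)]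
    {P : ∀ n, Measure (Ω n)} [∀ n, IsProbabilityMeasure (P n)]
    {Ω' : Type*} [MeasurableSpace Ω'] {P' : Measure Ω'} [IsProbabilityMeasure P']
    {l : Filter α} {U : ∀ n, Ω n → E} {W : ∀ n, Ω n → F} {U' : Ω' → E} {W' : Ω' → F}
    {κ : α → Kernel F E} [∀ n, IsMarkovKernel (κ n)] {κ' : Kernel F E} [IsMarkovKernel κ']
    {S : α → Set F} {ξ : F}
    (hκ : ∀ n, HasCondDistrib (U n) (W n) (κ n) (P n))
    (hS : ∀ n, ∀ᵐ w ∂(P n).map (W n), w ∈ S n)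
    (hlim : TendstoInDistribution (fun n ω ↦ (U n ω, W n ω)) l (fun ω ↦ (U' ω, W' ω)) P P')
    (hκ' : HasCondDistrib U' W' κ' P') (hcont : ContinuousAt (kernelLaw κ') ξ)
    (g : BoundedContinuousFunction E ℝ) (hg : 0 < ∫ z, g z ∂κ' ξ) :
    ∀ᶠ w₀ in 𝓝 ξ, w₀ ∈ (P'.map W').support → ∀ O ∈ 𝓝 w₀, ∀ᶠ n in l,
      ∃ w ∈ O ∩ S n, 0 < ∫ z, g z ∂κ n w := by
  have hgκ' : Tendsto (fun w ↦ ∫ z, g z ∂κ' w) (𝓝 ξ) (𝓝 (∫ z, g z ∂κ' ξ)) :=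
    ProbabilityMeasure.tendsto_iff_forall_integral_tendsto.1 hcont g
  have hnear : ∀ᶠ w in 𝓝 ξ, 0 < ∫ z, g z ∂κ' w := (tendsto_order.1 hgκ').1 _ hg
  filter_upwards [hnear.eventually_nhds] with w₀ hw₀ hsupp O hO
  obtain ⟨ρ, hρ, hball⟩ := Metric.mem_nhds_iff.1 (inter_mem hO hw₀)
  -- A continuous weight, positive exactly on a small ball around `w₀`.
  let φ : BoundedContinuousFunction F ℝ := BoundedContinuousFunction.ofNormedAddCommGroup
    (fun w ↦ max 0 (ρ - dist w w₀)) (by fun_prop) ρ fun w ↦ by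
      rw [Real.norm_of_nonneg (le_max_left _ _)]
      exact max_le hρ.le (by linarith [dist_nonneg (x := w) (y := w₀)])
  have hφ_apply (w : F) : φ w = max 0 (ρ - dist w w₀) := rfl
  have hφ0 (w : F) : 0 ≤ φ w := le_max_left _ _
  have hφball {w : F} (hw : w ∉ Metric.ball w₀ ρ) : φ w = 0 := by
    rw [Metric.mem_ball, not_lt] at hw
    rw [hφ_apply]
    exact max_eq_left (by linarith)
  have hlimit : 0 < ∫ ω, g (U' ω) * φ (W' ω) ∂P' := by
    obtain ⟨hi, he⟩ := integral_mul_eq_of_hasCondDistrib hκ' g φ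
    rw [he]
    refine (integral_pos_iff_support_of_nonneg (fun w ↦ ?_) hi).2 ?_
    · by_cases hw : w ∈ Metric.ball w₀ ρ
      · exact mul_nonneg (le_of_lt (hball hw).2) (hφ0 w)
      · simp [hφball hw]
    · refine ((Measure.mem_support_iff_forall _).1 hsupp _
        (Metric.ball_mem_nhds w₀ hρ)).trans_le (measure_mono fun w hw ↦ ?_)
      refine mul_ne_zero (ne_of_gt (hball hw).2) ?_
      rw [Metric.mem_ball] at hw
      rw [hφ_apply]
      exact (lt_max_of_lt_right (by linarith)).ne'
  let Φ : BoundedContinuousFunction (E × F) ℝ :=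
    g.compContinuous ⟨Prod.fst, continuous_fst⟩ * φ.compContinuous ⟨Prod.snd, continuous_snd⟩
  have hΦ : Tendsto (fun n ↦ ∫ ω, g (U n ω) * φ (W n ω) ∂P n) l
      (𝓝 (∫ ω, g (U' ω) * φ (W' ω) ∂P')) := by
    have := ProbabilityMeasure.tendsto_iff_forall_integral_tendsto.1 hlim.tendsto Φ
    simp only [ProbabilityMeasure.coe_mk] at this
    rw [integral_map hlim.aemeasurable_limit Φ.continuous.measurable.aestronglyMeasurable] at this
    refine this.congr fun n ↦ ?_
    exact integral_map (hlim.forall_aemeasurable n) Φ.continuous.measurable.aestronglyMeasurable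
  filter_upwards [(tendsto_order.1 hΦ).1 _ hlimit] with n hn
  by_contra! hcon
  rw [(integral_mul_eq_of_hasCondDistrib (hκ n) g φ).2] at hn
  refine hn.not_ge (integral_nonpos_of_ae ?_)
  filter_upwards [hS n] with w hw
  by_cases hwb : w ∈ Metric.ball w₀ ρ
  · exact mul_nonpos_of_nonpos_of_nonneg (hcon w ⟨(hball hwb).1, hw⟩) (hφ0 w)
  · simp [hφball hwb]

theorem eventually_nhds_exists_lt_integral {α E F : Type*}
    [TopologicalSpace E] [SecondCountableTopology E] [MeasurableSpace E] [BorelSpace E]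
    [PseudoMetricSpace F] [SecondCountableTopology F] [MeasurableSpace F] [BorelSpace F]
    {Ω : α → Type*} [∀ n, MeasurableSpace (Ω n)]
    {P : ∀ n, Measure (Ω n)} [∀ n, IsProbabilityMeasure (P n)]
    {Ω' : Type*} [MeasurableSpace Ω'] {P' : Measure Ω'} [IsProbabilityMeasure P']
    {l : Filter α} {U : ∀ n, Ω n → E} {W : ∀ n, Ω n → F} {U' : Ω' → E} {W' : Ω' → F}
    {κ : α → Kernel F E} [∀ n, IsMarkovKernel (κ n)] {κ' : Kernel F E} [IsMarkovKernel κ']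
    {S : α → Set F} {ξ : F}
    (hκ : ∀ n, HasCondDistrib (U n) (W n) (κ n) (P n))
    (hS : ∀ n, ∀ᵐ w ∂(P n).map (W n), w ∈ S n)
    (hlim : TendstoInDistribution (fun n ω ↦ (U n ω, W n ω)) l (fun ω ↦ (U' ω, W' ω)) P P')
    (hκ' : HasCondDistrib U' W' κ' P') (hcont : ContinuousAt (kernelLaw κ') ξ)
    (g : BoundedContinuousFunction E ℝ) {C : ℝ} (hg : C < ∫ z, g z ∂κ' ξ) :
    ∀ᶠ w₀ in 𝓝 ξ, w₀ ∈ (P'.map W').support → ∀ O ∈ 𝓝 w₀, ∀ᶠ n in l,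
      ∃ w ∈ O ∩ S n, C < ∫ z, g z ∂κ n w := by
  have hsub (ρ : Measure E) [IsProbabilityMeasure ρ] :
      ∫ z, (g - BoundedContinuousFunction.const E C) z ∂ρ = ∫ z, g z ∂ρ - C := by
    simp [integral_sub (g.integrable ρ)]
  have := eventually_nhds_exists_integral_pos hκ hS hlim hκ' hcont
    (g - BoundedContinuousFunction.const E C) (by rw [hsub]; linarith)
  simpa only [hsub, sub_pos] using this

/-- A continuous function lies between the indicators of two lower orthants, the larger one having
its corner strictly above that of the smaller one. -/
theorem exists_boundedContinuous_between_Iic {ι : Type*} [Fintype ι] (x : ι → ℝ) {δ : ℝ}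
    (hδ : 0 < δ) : ∃ g : BoundedContinuousFunction (ι → ℝ) ℝ,
      ∀ (ρ : Measure (ι → ℝ)) [IsProbabilityMeasure ρ], ρ.real (Set.Iic x) ≤ ∫ z, g z ∂ρ ∧
        ∫ z, g z ∂ρ ≤ ρ.real (Set.Iic (x + fun _ ↦ δ)) := by
  let f := thickenedIndicator hδ (Set.Iic x)
  have hf1 (z : ι → ℝ) : (f z : ℝ) ≤ 1 := thickenedIndicator_le_one hδ _ z
  let g : BoundedContinuousFunction (ι → ℝ) ℝ := BoundedContinuousFunction.ofNormedAddCommGroup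
    (fun z ↦ (f z : ℝ)) (NNReal.continuous_coe.comp f.continuous) 1 fun z ↦ by
      rw [Real.norm_of_nonneg (f z).coe_nonneg]
      exact hf1 z
  have hg (z : ι → ℝ) : g z = f z := rfl
  refine ⟨g, fun ρ _ ↦ ⟨?_, ?_⟩⟩
  · rw [← integral_indicator_one measurableSet_Iic]
    refine integral_mono ((integrable_const 1).indicator measurableSet_Iic) (g.integrable ρ)
      fun z ↦ Set.indicator_le' (fun z hz ↦ ?_) (fun z _ ↦ (f z).coe_nonneg) z
    simp [f, thickenedIndicator_one hδ _ hz]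
  · rw [← integral_indicator_one measurableSet_Iic]
    refine integral_mono (g.integrable ρ) ((integrable_const 1).indicator measurableSet_Iic)
      fun z ↦ ?_
    by_cases hz : z ∈ Set.Iic (x + fun _ ↦ δ)
    · rw [Set.indicator_of_mem hz]
      exact hf1 z
    · have hz' : z ∉ Metric.thickening δ (Set.Iic x) := by
        contrapose! hz
        obtain ⟨v, hv, hvz⟩ := Metric.mem_thickening_iff.1 hz
        intro i
        have h1 := (abs_lt.1 ((Real.dist_eq _ _).symm.trans_lt
          ((dist_le_pi_dist z v i).trans_lt hvz))).2
        have h2 := hv i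
        simp only [Pi.add_apply]
        linarith
      rw [hg, Set.indicator_of_notMem hz]
      simp [f, thickenedIndicator_zero hδ _ hz']

/-- Conditional limit theorem for stochastically increasing conditional laws. In any neighbourhood
of the limit `ξ` of the parameters `y n` there are parameters above, and others below, almost all
`y n`, at which the conditional laws of `U n` are almost those at `ξ` of the limit; monotonicity
transfers this to `y n`. The assumption `hF`, that the positive cone has interior points arbitrarily
close to the origin, provides parameters that are above, or below, a whole neighbourhood of `ξ`. -/
theorem tendsto_kernelLaw_of_stochIncreasingOn {α ι F : Type*} [Fintype ι]
    [NormedAddCommGroup F] [NormedSpace ℝ F] [PartialOrder F] [IsOrderedAddMonoid F]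
    [SecondCountableTopology F] [MeasurableSpace F] [BorelSpace F]
    {Ω : α → Type*} [∀ n, MeasurableSpace (Ω n)]
    {P : ∀ n, Measure (Ω n)} [∀ n, IsProbabilityMeasure (P n)]
    {Ω' : Type*} [MeasurableSpace Ω'] {P' : Measure Ω'} [IsProbabilityMeasure P']
    {l : Filter α} [l.IsCountablyGenerated]
    {U : ∀ n, Ω n → ι → ℝ} {W : ∀ n, Ω n → F} {U' : Ω' → ι → ℝ} {W' : Ω' → F}
    {κ : α → Kernel F (ι → ℝ)} [∀ n, IsMarkovKernel (κ n)]
    {κ' : Kernel F (ι → ℝ)} [IsMarkovKernel κ']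
    {S : α → Set F} {y : α → F} {ξ : F}
    (hF : ∃ᶠ e in 𝓝 (0 : F), Set.Ici 0 ∈ 𝓝 e)
    (hκ : ∀ n, HasCondDistrib (U n) (W n) (κ n) (P n))
    (hS : ∀ n, ∀ᵐ w ∂(P n).map (W n), w ∈ S n)
    (hinc : ∀ᶠ n in l, StochIncreasingOn (κ n) (S n))
    (hlim : TendstoInDistribution (fun n ω ↦ (U n ω, W n ω)) l (fun ω ↦ (U' ω, W' ω)) P P')
    (hyS : ∀ n, y n ∈ S n) (hy : Tendsto y l (𝓝 ξ))
    (hξ : ξ ∈ interior (P'.map W').support)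
    (hκ' : HasCondDistrib U' W' κ' P') (hcont : ContinuousAt (kernelLaw κ') ξ) :
    Tendsto (fun n ↦ kernelLaw (κ n) (y n)) l (𝓝 (kernelLaw κ' ξ)) := by
  have hsupp : ∀ᶠ w in 𝓝 ξ, w ∈ (P'.map W').support := mem_interior_iff_mem_nhds.1 hξ
  have habove : ∃ᶠ w in 𝓝 ξ, ∀ᶠ p in 𝓝 w ×ˢ 𝓝 ξ, p.2 ≤ p.1 := by
    have ht : Tendsto (fun e : F ↦ ξ + e) (𝓝 0) (𝓝 ξ) := by
      simpa using (continuous_const_add ξ).tendsto (0 : F)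
    refine ht.frequently (hF.mono fun e he ↦ ?_)
    have : Tendsto (fun p : F × F ↦ p.1 - p.2) (𝓝 (ξ + e) ×ˢ 𝓝 ξ) (𝓝 e) := by
      simpa using (tendsto_fst (f := 𝓝 (ξ + e)) (g := 𝓝 ξ)).sub tendsto_snd
    filter_upwards [this he] with p hp
    exact sub_nonneg.1 hp
  have hbelow : ∃ᶠ w in 𝓝 ξ, ∀ᶠ p in 𝓝 w ×ˢ 𝓝 ξ, p.1 ≤ p.2 := by
    have ht : Tendsto (fun e : F ↦ ξ - e) (𝓝 0) (𝓝 ξ) := by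
      simpa using (continuous_sub_left ξ).tendsto (0 : F)
    refine ht.frequently (hF.mono fun e he ↦ ?_)
    have : Tendsto (fun p : F × F ↦ p.2 - p.1) (𝓝 (ξ - e) ×ˢ 𝓝 ξ) (𝓝 e) := by
      simpa using (tendsto_snd (f := 𝓝 (ξ - e)) (g := 𝓝 ξ)).sub tendsto_fst
    filter_upwards [this he] with p hp
    exact sub_nonneg.1 hp
  refine tendsto_probabilityMeasure_of_Iic_sandwich (fun x δ hδ ε hε ↦ ?_)
    (fun x δ hδ ε hε ↦ ?_)
  -- The upper bound: compare with parameters below `y n`, whose distribution functions are larger.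
  · obtain ⟨g, hg⟩ := exists_boundedContinuous_between_Iic x hδ
    have hneg (ρ : Measure (ι → ℝ)) : ∫ z, (-g) z ∂ρ = -∫ z, g z ∂ρ := by
      simp [integral_neg]
    obtain ⟨w₀, hw₀, hloc, hs⟩ := (hbelow.and_eventually
      ((eventually_nhds_exists_lt_integral hκ hS hlim hκ' hcont (-g)
        (C := -∫ z, g z ∂κ' ξ - ε) (by rw [hneg]; linarith)).and hsupp)).exists
    obtain ⟨O, hO, V, hV, hOV⟩ := mem_prod_iff.1 hw₀
    filter_upwards [hloc hs O hO, hy hV, hinc] with n ⟨w, hw, hwg⟩ hyV hn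
    have h1 : κ n (y n) (Set.Iic x) ≤ κ n w (Set.Iic x) :=
      hn x w hw.2 (y n) (hyS n) (hOV (Set.mk_mem_prod hw.1 hyV))
    have h2 : (κ n (y n)).real (Set.Iic x) ≤ (κ n w).real (Set.Iic x) :=
      ENNReal.toReal_mono (measure_ne_top _ _) h1
    rw [hneg] at hwg
    change (κ n (y n)).real (Set.Iic x) ≤ (κ' ξ).real _ + ε
    linarith [(hg (κ n w)).1, (hg (κ' ξ)).2]
  · obtain ⟨g, hg⟩ := exists_boundedContinuous_between_Iic (x - fun _ ↦ δ) hδ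
    rw [sub_add_cancel] at hg
    obtain ⟨w₀, hw₀, hloc, hs⟩ := (habove.and_eventually
      ((eventually_nhds_exists_lt_integral hκ hS hlim hκ' hcont g
        (C := ∫ z, g z ∂κ' ξ - ε) (by linarith)).and hsupp)).exists
    obtain ⟨O, hO, V, hV, hOV⟩ := mem_prod_iff.1 hw₀
    filter_upwards [hloc hs O hO, hy hV, hinc] with n ⟨w, hw, hwg⟩ hyV hn
    have h1 : κ n w (Set.Iic x) ≤ κ n (y n) (Set.Iic x) :=
      hn x (y n) (hyS n) w hw.2 (hOV (Set.mk_mem_prod hw.1 hyV))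
    have h2 : (κ n w).real (Set.Iic x) ≤ (κ n (y n)).real (Set.Iic x) :=
      ENNReal.toReal_mono (measure_ne_top _ _) h1
    change (κ' ξ).real _ - ε ≤ (κ n (y n)).real (Set.Iic x)
    linarith [(hg (κ n w)).2, (hg (κ' ξ)).1]

/-! ### Normalisation and stochastically monotone laws -/

/-- The rescaled form of `tendsto_kernelLaw_of_stochIncreasingOn`, for conditional laws that are
stochastically increasing after a linear change of coordinates. -/
theorem tendsto_kernelLaw_map_of_stochIncreasingOn {α ι F : Type*} [Fintype ι]
    [NormedAddCommGroup F] [NormedSpace ℝ F] [PartialOrder F] [IsOrderedAddMonoid F]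
    [PosSMulMono ℝ F] [SecondCountableTopology F] [MeasurableSpace F] [BorelSpace F]
    {Ω : α → Type*} [∀ n, MeasurableSpace (Ω n)]
    {P : ∀ n, Measure (Ω n)} [∀ n, IsProbabilityMeasure (P n)]
    {Ω' : Type*} [MeasurableSpace Ω'] {P' : Measure Ω'} [IsProbabilityMeasure P']
    {l : Filter α} [l.IsCountablyGenerated]
    {X : ∀ n, Ω n → ι → ℝ} {Y : ∀ n, Ω n → F} {X' : Ω' → ι → ℝ} {Y' : Ω' → F}
    (L : (ι → ℝ) ≃L[ℝ] (ι → ℝ))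
    {a c : α → ℝ} (ha : ∀ n, 0 < a n) (hc : ∀ n, 0 < c n) {b : α → ι → ℝ} {d y : α → F} {ξ : F}
    {κ : α → Kernel F (ι → ℝ)} [∀ n, IsMarkovKernel (κ n)]
    {κ' : Kernel F (ι → ℝ)} [IsMarkovKernel κ'] {S : α → Set F}
    (hF : ∃ᶠ e in 𝓝 (0 : F), Set.Ici 0 ∈ 𝓝 e)
    (hκ : ∀ n, HasCondDistrib (X n) (Y n) (κ n) (P n))
    (hS : ∀ n, ∀ᵐ w ∂(P n).map (Y n), w ∈ S n)
    (hinc : ∀ᶠ n in l, StochIncreasingOn ((κ n).map L) (S n))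
    (hlim : TendstoInDistribution (fun n ω ↦ ((a n)⁻¹ • (X n ω - b n), (c n)⁻¹ • (Y n ω - d n)))
      l (fun ω ↦ (X' ω, Y' ω)) P P')
    (hyS : ∀ n, y n ∈ S n) (hy : Tendsto (fun n ↦ (c n)⁻¹ • (y n - d n)) l (𝓝 ξ))
    (hξ : ξ ∈ interior (P'.map Y').support)
    (hκ' : HasCondDistrib X' Y' κ' P') (hcont : ContinuousAt (kernelLaw κ') ξ) :
    Tendsto (fun n ↦ (kernelLaw (κ n) (y n)).map (f := fun x ↦ (a n)⁻¹ • (x - b n))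
      (by fun_prop)) l (𝓝 (kernelLaw κ' ξ)) := by
  -- `A n` and `H n` are the normalisations, and `G n` is the inverse of `H n`.
  let A : α → (ι → ℝ) → ι → ℝ := fun n x ↦ L ((a n)⁻¹ • (x - b n))
  have hA (n) : Measurable (A n) := L.continuous.measurable.comp (by fun_prop)
  let G : α → F → F := fun n w ↦ c n • w + d n
  have hG (n) : Measurable (G n) := by fun_prop
  let H : α → F → F := fun n w ↦ (c n)⁻¹ • (w - d n)
  have hH (n) : Measurable (H n) := by fun_prop
  have hGH (n) (w : F) : G n (H n w) = w := by simp [G, H, smul_smul, (hc n).ne']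
  have hHG (n) (w : F) : H n (G n w) = w := by simp [G, H, smul_smul, (hc n).ne']
  let η : α → Kernel F (ι → ℝ) := fun n ↦ ((κ n).map (A n)).comap (G n) (hG n)
  have hA_markov (n : α) : IsMarkovKernel ((κ n).map (A n)) := Kernel.IsMarkovKernel.map _ (hA n)
  have hη_markov (n : α) : IsMarkovKernel (η n) := inferInstanceAs
    (IsMarkovKernel (((κ n).map (A n)).comap (G n) (hG n)))
  have hη (n) (w : F) : η n w = (κ n (G n w)).map (A n) := by
    simp [η, Kernel.comap_apply, Kernel.map_apply _ (hA n)]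
  have : IsMarkovKernel (κ'.map L) := Kernel.IsMarkovKernel.map _ L.continuous.measurable
  have hL : Measurable L := L.continuous.measurable
  have hcond (n) : HasCondDistrib (fun ω ↦ A n (X n ω)) (fun ω ↦ H n (Y n ω)) (η n) (P n) := by
    refine HasCondDistrib.comp_right (f := H n) (hf := hH n) ?_
    have : (η n).comap (H n) (hH n) = (κ n).map (A n) := by
      ext1 w
      rw [Kernel.comap_apply, hη, hGH, Kernel.map_apply _ (hA n)]
    rw [this]
    exact (hκ n).comp_left (hA n)
  have hmem (n) : ∀ᵐ w ∂(P n).map (fun ω ↦ H n (Y n ω)), w ∈ G n ⁻¹' S n := by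
    have : (P n).map (fun ω ↦ H n (Y n ω)) = ((P n).map (Y n)).map (H n) :=
      (AEMeasurable.map_map_of_aemeasurable (hH n).aemeasurable (hκ n).aemeasurable_fst).symm
    rw [this]
    have hemb : MeasurableEmbedding (H n) :=
      (MeasurableEquiv.mk ⟨H n, G n, hGH n, hHG n⟩ (hH n) (hG n)).measurableEmbedding
    rw [hemb.ae_map_iff]
    filter_upwards [hS n] with w hw
    simpa [hGH] using hw
  have hinc' : ∀ᶠ n in l, StochIncreasingOn (η n) (G n ⁻¹' S n) := by
    filter_upwards [hinc] with n hn x w₁ hw₁ w₂ hw₂ hw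
    have hpre (w : F) : η n w (Set.Iic x) =
        (κ n).map L (G n w) (Set.Iic (a n • x + L (b n))) := by
      rw [hη, Measure.map_apply (hA n) measurableSet_Iic, Kernel.map_apply' _ hL _
        measurableSet_Iic]
      congr 1
      ext z
      simp only [Set.mem_preimage, Set.mem_Iic, A, map_smul, map_sub]
      rw [inv_smul_le_iff_of_pos (ha n), sub_le_iff_le_add]
    rw [hpre, hpre]
    exact hn _ _ hw₁ _ hw₂ (by simp only [G]; gcongr; exact (hc n).le)
  have hlim' : TendstoInDistribution (fun n ω ↦ (A n (X n ω), H n (Y n ω))) l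
      (fun ω ↦ (L (X' ω), Y' ω)) P P' :=
    hlim.continuous_comp (g := Prod.map L id) (L.continuous.prodMap continuous_id)
  have hcont' : ContinuousAt (kernelLaw (κ'.map L)) ξ := by
    have heq : kernelLaw (κ'.map L) = fun w ↦
        (kernelLaw κ' w).map L.continuous.measurable.aemeasurable :=
      funext fun w ↦ Subtype.ext (Kernel.map_apply _ hL _)
    rw [heq]
    exact (ProbabilityMeasure.continuous_map L.continuous).continuousAt.comp hcont
  have main := tendsto_kernelLaw_of_stochIncreasingOn hF hcond hmem hinc' hlim'
    (y := fun n ↦ H n (y n)) (fun n ↦ by simpa [hGH] using hyS n) hy hξ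
    (hκ'.comp_left hL) hcont'
  have main' := ((ProbabilityMeasure.continuous_map L.symm.continuous).tendsto _).comp main
  have hlimit : (kernelLaw (κ'.map L) ξ).map L.symm.continuous.measurable.aemeasurable =
      kernelLaw κ' ξ := by
    refine Subtype.ext ?_
    change ((κ'.map L) ξ).map L.symm = κ' ξ
    rw [Kernel.map_apply _ hL, Measure.map_map L.symm.continuous.measurable hL]
    simp
  rw [hlimit] at main'
  refine main'.congr fun n ↦ Subtype.ext ?_
  change (η n (H n (y n))).map L.symm = (κ n (y n)).map fun x ↦ (a n)⁻¹ • (x - b n)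
  rw [hη, hGH, Measure.map_map L.symm.continuous.measurable (hA n)]
  congr 1
  ext1 x
  simp [A]

/-- Conditional limit theorem for stochastically monotone conditional laws. The sequence is split
into the indices with increasing and those with decreasing conditional laws; the second case
reduces to the first one by a reflection. -/
theorem tendsto_kernelLaw_map_of_stochMonotoneWrt {ι F : Type*} [Fintype ι]
    [NormedAddCommGroup F] [NormedSpace ℝ F] [PartialOrder F] [IsOrderedAddMonoid F]
    [PosSMulMono ℝ F] [SecondCountableTopology F] [MeasurableSpace F] [BorelSpace F]
    {Ω : ℕ → Type*} [∀ n, MeasurableSpace (Ω n)]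
    {P : ∀ n, Measure (Ω n)} [∀ n, IsProbabilityMeasure (P n)]
    {Ω' : Type*} [MeasurableSpace Ω'] {P' : Measure Ω'} [IsProbabilityMeasure P']
    {X : ∀ n, Ω n → ι → ℝ} {Y : ∀ n, Ω n → F} {X' : Ω' → ι → ℝ} {Y' : Ω' → F}
    (T : (ι → ℝ) ≃ₗ[ℝ] (ι → ℝ))
    {a c : ℕ → ℝ} (ha : ∀ n, 0 < a n) (hc : ∀ n, 0 < c n) {b : ℕ → ι → ℝ} {d y : ℕ → F} {ξ : F}
    {κ : ℕ → Kernel F (ι → ℝ)} [∀ n, IsMarkovKernel (κ n)]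
    {κ' : Kernel F (ι → ℝ)} [IsMarkovKernel κ'] {S : ℕ → Set F}
    (hF : ∃ᶠ e in 𝓝 (0 : F), Set.Ici 0 ∈ 𝓝 e)
    (hκ : ∀ n, HasCondDistrib (X n) (Y n) (κ n) (P n))
    (hmono : ∀ n, StochMonotoneWrt (fun ω ↦ T (X n ω)) (Y n) (P n) ((κ n).map T) (S n))
    (hlim : TendstoInDistribution (fun n ω ↦ ((a n)⁻¹ • (X n ω - b n), (c n)⁻¹ • (Y n ω - d n)))
      atTop (fun ω ↦ (X' ω, Y' ω)) P P')
    (hyS : ∀ n, y n ∈ S n) (hy : Tendsto (fun n ↦ (c n)⁻¹ • (y n - d n)) atTop (𝓝 ξ))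
    (hξ : ξ ∈ interior (P'.map Y').support)
    (hκ' : HasCondDistrib X' Y' κ' P') (hcont : ContinuousAt (kernelLaw κ') ξ) :
    Tendsto (fun n ↦ (kernelLaw (κ n) (y n)).map (f := fun x ↦ (a n)⁻¹ • (x - b n))
      (by fun_prop)) atTop (𝓝 (kernelLaw κ' ξ)) := by
  have hS (n : ℕ) : ∀ᵐ w ∂(P n).map (Y n), w ∈ S n := (hmono n).elim (·.ae_mem) (·.ae_mem)
  have hsub (l : Filter ℕ) (hl : l ≤ atTop) :
      TendstoInDistribution (fun n ω ↦ ((a n)⁻¹ • (X n ω - b n), (c n)⁻¹ • (Y n ω - d n)))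
        l (fun ω ↦ (X' ω, Y' ω)) P P' :=
    ⟨hlim.forall_aemeasurable, hlim.aemeasurable_limit, hlim.tendsto.mono_left hl⟩
  let I : Set ℕ := {n | StochIncreasingOn ((κ n).map T) (S n)}
  have hsplit : (atTop : Filter ℕ) = atTop ⊓ 𝓟 I ⊔ atTop ⊓ 𝓟 Iᶜ := by
    rw [← inf_sup_left, sup_principal, Set.union_compl_self, principal_univ, inf_top_eq]
  rw [hsplit]
  refine Tendsto.sup ?_ ?_
  · exact tendsto_kernelLaw_map_of_stochIncreasingOn T.toContinuousLinearEquiv ha hc hF hκ hS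
      (eventually_inf_principal.2 (Eventually.of_forall fun n hn ↦ hn)) (hsub _ inf_le_left) hyS
      (hy.mono_left inf_le_left) hξ hκ' hcont
  · refine tendsto_kernelLaw_map_of_stochIncreasingOn
      (T.toContinuousLinearEquiv.trans (ContinuousLinearEquiv.neg ℝ)) ha hc hF hκ hS
      (eventually_inf_principal.2 (Eventually.of_forall fun n hn ↦ ?_)) (hsub _ inf_le_left) hyS
      (hy.mono_left inf_le_left) hξ hκ' hcont
    rcases hmono n with h | h
    · exact absurd h.increasing hn
    · have hinc := h.increasing
      have hT : Measurable T := T.toContinuousLinearEquiv.continuous.measurable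
      rw [← Kernel.map_comp_right (κ n) (f := T) hT (g := fun x ↦ -x) measurable_neg] at hinc
      exact hinc

/-! ### Conditional laws of a Gaussian vector -/

theorem support_map_eq_univ_of_hasGaussianLaw {Ω : Type*} [MeasurableSpace Ω] {P : Measure Ω}
    {Y : Ω → ℝ} (hY : HasGaussianLaw Y P) (hv : 0 < Var[Y; P]) : (P.map Y).support = Set.univ := by
  rw [hY.map_eq_gaussianReal]
  have hac := gaussianReal_absolutelyContinuous' (P[Y]) (v := Var[Y; P].toNNReal)
    (by simpa using hv)
  exact Set.univ_subset_iff.1 (Measure.support_eq_univ.symm.subset.trans hac.support_mono)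

/-- The regression residual of a Gaussian vector is independent of the regressor, being jointly
Gaussian and uncorrelated with it. -/
theorem indepFun_sub_smul_of_hasGaussianLaw {Ω ι : Type*} [Fintype ι] [MeasurableSpace Ω]
    {P : Measure Ω} {X : Ω → ι → ℝ} {Y : Ω → ℝ}
    (h : HasGaussianLaw (fun ω ↦ (X ω, Y ω)) P) (hv : 0 < Var[Y; P]) {γ : ι → ℝ}
    (hγ : ∀ i, γ i = cov[fun ω ↦ X ω i, Y; P] / Var[Y; P]) :
    IndepFun (fun ω ↦ X ω - Y ω • γ) Y P := by
  have := h.isProbabilityMeasure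
  let L : ((ι → ℝ) × ℝ) →L[ℝ] (ι → ℝ) × (Unit → ℝ) :=
    ContinuousLinearMap.prod
      (ContinuousLinearMap.fst ℝ (ι → ℝ) ℝ - (ContinuousLinearMap.snd ℝ (ι → ℝ) ℝ).smulRight γ)
      (ContinuousLinearMap.pi fun _ ↦ ContinuousLinearMap.snd ℝ (ι → ℝ) ℝ)
  have hL : HasGaussianLaw (fun ω ↦ (fun i ↦ X ω i - Y ω * γ i, fun _ : Unit ↦ Y ω)) P :=
    h.map_fun L
  have hX (i : ι) : MemLp (fun ω ↦ X ω i) 2 P := (h.fst.eval i).memLp_two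
  have hY : MemLp Y 2 P := h.snd.memLp_two
  have hind := HasGaussianLaw.indepFun_of_covariance_eval
    (X := fun i ω ↦ X ω i - Y ω * γ i) (Y := fun _ : Unit ↦ Y) hL fun i _ ↦ by
      rw [covariance_fun_sub_left (hX i) (hY.mul_const _) hY, covariance_mul_const_left,
        covariance_self hY.aemeasurable, hγ]
      field_simp
      ring
  exact hind.comp measurable_id (measurable_pi_apply ())

/-- The kernel `y ↦ L(V + y γ)`, for `V` of law `ρ`. -/
noncomputable def translationKernel {ι : Type*} (ρ : Measure (ι → ℝ)) [SFinite ρ] (γ : ι → ℝ) :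
    Kernel ℝ (ι → ℝ) :=
  (Kernel.id ×ₖ Kernel.const ℝ ρ).map fun p : ℝ × (ι → ℝ) ↦ p.2 + p.1 • γ

theorem translationKernel_apply {ι : Type*} (ρ : Measure (ι → ℝ)) [SFinite ρ] (γ : ι → ℝ) (y : ℝ) :
    translationKernel ρ γ y = ρ.map fun v ↦ v + y • γ := by
  rw [translationKernel, Kernel.map_apply _ (by fun_prop), Kernel.prod_apply, Kernel.id_apply,
    Kernel.const_apply, Measure.dirac_prod, Measure.map_map (by fun_prop) (by fun_prop)]
  rfl

instance isMarkovKernel_translationKernel {ι : Type*} (ρ : Measure (ι → ℝ)) [IsProbabilityMeasure ρ] (γ : ι → ℝ) :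
    IsMarkovKernel (translationKernel ρ γ) :=
  Kernel.IsMarkovKernel.map _ (by fun_prop)

theorem continuous_kernelLaw_translationKernel {ι : Type*} [Fintype ι] (ρ : Measure (ι → ℝ))
    [IsProbabilityMeasure ρ] (γ : ι → ℝ) : Continuous (kernelLaw (translationKernel ρ γ)) := by
  refine continuous_iff_continuousAt.2 fun y ↦
    ProbabilityMeasure.tendsto_iff_forall_integral_tendsto.2 fun g ↦ ?_
  have hint (t : ℝ) : ∫ z, g z ∂(kernelLaw (translationKernel ρ γ) t : Measure (ι → ℝ)) =
      ∫ v, g (v + t • γ) ∂ρ := by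
    change ∫ z, g z ∂(translationKernel ρ γ t) = _
    rw [translationKernel_apply, integral_map (by fun_prop)
      g.continuous.measurable.aestronglyMeasurable]
  simp only [hint]
  refine tendsto_integral_filter_of_dominated_convergence (fun _ ↦ ‖g‖)
    (Eventually.of_forall fun t ↦ ?_)
    (Eventually.of_forall fun t ↦ ae_of_all _ fun v ↦ g.norm_coe_le_norm _)
    (integrable_const _) (ae_of_all _ fun v ↦ ?_)
  · exact (g.continuous.comp (by fun_prop)).measurable.aestronglyMeasurable
  · exact (g.continuous.comp (by fun_prop : Continuous fun t : ℝ ↦ v + t • γ)).tendsto y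

/-- If `X - Y γ` is independent of `Y`, then the translates of its law by `y γ` form a version of the
conditional law of `X` given `Y = y`. -/
theorem hasCondDistrib_translationKernel {Ω ι : Type*} [Fintype ι] [MeasurableSpace Ω]
    {P : Measure Ω} [IsProbabilityMeasure P] {X : Ω → ι → ℝ} {Y : Ω → ℝ} {γ : ι → ℝ}
    (hX : AEMeasurable X P) (hY : AEMeasurable Y P)
    (hind : IndepFun (fun ω ↦ X ω - Y ω • γ) Y P) :
    HasCondDistrib X Y (translationKernel (P.map fun ω ↦ X ω - Y ω • γ) γ) P := by
  have hV : AEMeasurable (fun ω ↦ X ω - Y ω • γ) P := by fun_prop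
  have := Measure.isProbabilityMeasure_map hV
  have := Measure.isProbabilityMeasure_map hY
  refine ⟨hY.prodMk hX, ?_⟩
  have hjoint := (indepFun_iff_map_prod_eq_prod_map_map hY hV).1 hind.symm
  have hmap : P.map (fun ω ↦ (Y ω, X ω)) =
      ((P.map Y).prod (P.map fun ω ↦ X ω - Y ω • γ)).map fun p ↦ (p.1, p.2 + p.1 • γ) := by
    rw [← hjoint, AEMeasurable.map_map_of_aemeasurable (by fun_prop) (hY.prodMk hV)]
    congr 1
    ext ω <;> simp
  have hm : Measurable fun p : ℝ × (ι → ℝ) ↦ (p.1, p.2 + p.1 • γ) := by fun_prop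
  ext s hs
  rw [hmap, Measure.map_apply hm hs, Measure.prod_apply (hm hs), Measure.compProd_apply hs]
  refine lintegral_congr fun y ↦ ?_
  rw [translationKernel_apply, Measure.map_apply (by fun_prop) (measurable_prodMk_left hs)]
  rfl

/-! ### Cones with interior and the conditional limit theorem -/

theorem frequently_Ici_mem_nhds_real : ∃ᶠ e in 𝓝 (0 : ℝ), Set.Ici 0 ∈ 𝓝 e := by
  have h : ∀ᶠ e in 𝓝[>] (0 : ℝ), Set.Ici 0 ∈ 𝓝 e := by
    filter_upwards [self_mem_nhdsWithin] with e he using Ici_mem_nhds he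
  exact h.frequently.filter_mono nhdsWithin_le_nhds

theorem frequently_Ici_mem_nhds_pi {ι : Type*} [Finite ι] :
    ∃ᶠ e in 𝓝 (0 : ι → ℝ), Set.Ici 0 ∈ 𝓝 e := by
  have ht : Tendsto (fun t : ℝ ↦ fun _ : ι ↦ t) (𝓝[>] 0) (𝓝 0) :=
    (by fun_prop : Continuous fun t : ℝ ↦ fun _ : ι ↦ t).tendsto' 0 0 rfl |>.mono_left
      nhdsWithin_le_nhds
  have h : ∀ᶠ t in 𝓝[>] (0 : ℝ), Set.Ici 0 ∈ 𝓝 (fun _ : ι ↦ t) := by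
    filter_upwards [self_mem_nhdsWithin] with t ht using pi_Ici_mem_nhds fun _ ↦ ht
  exact ht.frequently h.frequently

theorem tendstoInDistribution_of_tendsto_kernelLaw_map {ι F Ω' : Type*} [Fintype ι]
    [MeasurableSpace F]
    {Ωt : ℕ → Type*} [∀ n, MeasurableSpace (Ωt n)]
    {Pt : ∀ n, Measure (Ωt n)} [∀ n, IsProbabilityMeasure (Pt n)]
    [MeasurableSpace Ω'] {P' : Measure Ω'} [IsProbabilityMeasure P']
    {Xt : ∀ n, Ωt n → ι → ℝ} {Z : Ω' → ι → ℝ} {a : ℕ → ℝ} {b : ℕ → ι → ℝ} {y : ℕ → F} {ξ : F}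
    {κ : ℕ → Kernel F (ι → ℝ)} [∀ n, IsMarkovKernel (κ n)]
    {κ' : Kernel F (ι → ℝ)} [IsMarkovKernel κ']
    (hXt : ∀ n, HasLaw (Xt n) (κ n (y n)) (Pt n)) (hZ : HasLaw Z (κ' ξ) P')
    (h : Tendsto (fun n ↦ (kernelLaw (κ n) (y n)).map (f := fun x ↦ (a n)⁻¹ • (x - b n))
      (by fun_prop)) atTop (𝓝 (kernelLaw κ' ξ))) :
    TendstoInDistribution (fun n ω ↦ (a n)⁻¹ • (Xt n ω - b n)) atTop Z Pt P' := by
  have hm (n : ℕ) : AEMeasurable (fun ω ↦ (a n)⁻¹ • (Xt n ω - b n)) (Pt n) :=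
    ((hXt n).aemeasurable.sub_const (b n)).const_smul (a n)⁻¹
  refine ⟨hm, hZ.aemeasurable, ?_⟩
  have hlimit : (⟨P'.map Z, Measure.isProbabilityMeasure_map hZ.aemeasurable⟩ :
      ProbabilityMeasure (ι → ℝ)) = kernelLaw κ' ξ := Subtype.ext hZ.map_eq
  rw [hlimit]
  refine h.congr fun n ↦ Subtype.ext ?_
  change (κ n (y n)).map (fun x ↦ (a n)⁻¹ • (x - b n)) = _
  rw [← (hXt n).map_eq, AEMeasurable.map_map_of_aemeasurable (by fun_prop) (hXt n).aemeasurable]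
  rfl

/-- The first conjunct is the general conditional limit theorem, the second one the case of a
jointly normal limit with a real conditioning variable. In both, `κ n` is the version of
`y ↦ L(X n | Y n = y)` whose image under `T` is stochastically monotone over `S n ∋ y n`, and
`Xt n` is a random vector with law `L(X n | Y n = y n)`. -/
theorem corollary2p5
    (q : ℕ) (hq : 1 ≤ q)
    -- the spaces on which `(X n, Y n)`, `(X, Y)` and `Xt n` are defined
    {Ω : ℕ → Type*} [∀ n, MeasurableSpace (Ω n)]
    (P : ∀ n, Measure (Ω n)) [∀ n, IsProbabilityMeasure (P n)]
    {Ω' : Type*} [MeasurableSpace Ω'] (P' : Measure Ω') [IsProbabilityMeasure P']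
    {Ωt : ℕ → Type*} [∀ n, MeasurableSpace (Ωt n)]
    (Pt : ∀ n, Measure (Ωt n)) [∀ n, IsProbabilityMeasure (Pt n)]
    (X : ∀ n, Ω n → Fin q → ℝ) (X' : Ω' → Fin q → ℝ) (Xt : ∀ n, Ωt n → Fin q → ℝ)
    (T : (Fin q → ℝ) ≃ₗ[ℝ] (Fin q → ℝ))
    (a c : ℕ → ℝ) (ha : ∀ n, 0 < a n) (hc : ∀ n, 0 < c n) (b : ℕ → Fin q → ℝ) :
    (∀ (r : ℕ), 1 ≤ r →
      ∀ (Y : ∀ n, Ω n → Fin r → ℝ) (Y' : Ω' → Fin r → ℝ)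
        (d y : ℕ → Fin r → ℝ) (ξ : Fin r → ℝ)
        (κ : ℕ → Kernel (Fin r → ℝ) (Fin q → ℝ)) [∀ n, IsMarkovKernel (κ n)]
        (S : ℕ → Set (Fin r → ℝ))
        (κ' : Kernel (Fin r → ℝ) (Fin q → ℝ)) [IsMarkovKernel κ'],
      (∀ n, HasCondDistrib (X n) (Y n) (κ n) (P n)) →
      (∀ n, StochMonotoneWrt (fun ω ↦ T (X n ω)) (Y n) (P n) ((κ n).map T) (S n)) →
      TendstoInDistribution
        (fun n ω ↦ ((a n)⁻¹ • (X n ω - b n), (c n)⁻¹ • (Y n ω - d n)))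
        atTop (fun ω ↦ (X' ω, Y' ω)) P P' →
      (∀ n, y n ∈ S n) →
      Tendsto (fun n ↦ (c n)⁻¹ • (y n - d n)) atTop (𝓝 ξ) →
      (∀ n, HasLaw (Xt n) (κ n (y n)) (Pt n)) →
      ξ ∈ interior (P'.map Y').support →
      HasCondDistrib X' Y' κ' P' →
      ContinuousAt (kernelLaw κ') ξ →
      TendstoInDistribution (fun n ω ↦ (a n)⁻¹ • (Xt n ω - b n)) atTop id Pt (κ' ξ))
    ∧
    (∀ (Y : ∀ n, Ω n → ℝ) (Y' : Ω' → ℝ) (d y : ℕ → ℝ) (ξ : ℝ)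
        (κ : ℕ → Kernel ℝ (Fin q → ℝ)) [∀ n, IsMarkovKernel (κ n)] (S : ℕ → Set ℝ)
        (γ : Fin q → ℝ) (X'' : Ω' → Fin q → ℝ),
      (∀ n, HasCondDistrib (X n) (Y n) (κ n) (P n)) →
      (∀ n, StochMonotoneWrt (fun ω ↦ T (X n ω)) (Y n) (P n) ((κ n).map T) (S n)) →
      TendstoInDistribution
        (fun n ω ↦ ((a n)⁻¹ • (X n ω - b n), (c n)⁻¹ * (Y n ω - d n)))
        atTop (fun ω ↦ (X' ω, Y' ω)) P P' →
      HasGaussianLaw (fun ω ↦ (X' ω, Y' ω)) P' →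
      0 < Var[Y'; P'] →
      (∀ n, y n ∈ S n) →
      Tendsto (fun n ↦ (c n)⁻¹ * (y n - d n)) atTop (𝓝 ξ) →
      (∀ n, HasLaw (Xt n) (κ n (y n)) (Pt n)) →
      (∀ i, γ i = cov[fun ω ↦ X' ω i, Y'; P'] / Var[Y'; P']) →
      (∀ ω, X'' ω = X' ω + (ξ - Y' ω) • γ) →
      TendstoInDistribution (fun n ω ↦ (a n)⁻¹ • (Xt n ω - b n)) atTop X'' Pt P' ∧
      HasGaussianLaw X'' P' ∧
      (∀ i, (∫ ω, X'' ω i ∂P') = (∫ ω, X' ω i ∂P') + (ξ - (∫ ω, Y' ω ∂P')) * γ i) ∧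
      (∀ i j, cov[fun ω ↦ X'' ω i, fun ω ↦ X'' ω j; P'] =
        cov[fun ω ↦ X' ω i, fun ω ↦ X' ω j; P'] -
          cov[fun ω ↦ X' ω i, Y'; P'] * cov[fun ω ↦ X' ω j, Y'; P'] / Var[Y'; P'])) := by
  refine ⟨?_, ?_⟩
  · intro r _ Y Y' d y ξ κ _ S κ' _ hκ hmono hlim hyS hy hXt hξ hκ' hcont
    exact tendstoInDistribution_of_tendsto_kernelLaw_map hXt ⟨aemeasurable_id, Measure.map_id⟩
      (tendsto_kernelLaw_map_of_stochMonotoneWrt T ha hc frequently_Ici_mem_nhds_pi hκ hmono hlim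
        hyS hy hξ hκ' hcont)
  · intro Y Y' d y ξ κ _ S γ X'' hκ hmono hlim hG hv hyS hy hXt hγ hX''
    have hX''_eq : X'' = fun ω ↦ X' ω + (ξ - Y' ω) • γ := funext hX''
    have hX'm : AEMeasurable X' P' := hG.fst.aemeasurable
    have hY'm : AEMeasurable Y' P' := hG.snd.aemeasurable
    have hV : AEMeasurable (fun ω ↦ X' ω - Y' ω • γ) P' := by fun_prop
    have hV_prob := Measure.isProbabilityMeasure_map hV
    set ρ := P'.map fun ω ↦ X' ω - Y' ω • γ
    -- `X'' = (X' - Y' γ) + ξ γ` has the conditional law of `X'` given `Y' = ξ`.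
    have hlaw : HasLaw X'' (translationKernel ρ γ ξ) P' := by
      refine ⟨by rw [hX''_eq]; fun_prop, ?_⟩
      rw [translationKernel_apply, AEMeasurable.map_map_of_aemeasurable (by fun_prop) hV, hX''_eq]
      congr 1
      ext1 ω
      simp only [Function.comp_apply, sub_smul]
      abel
    have hXi (i : Fin q) : MemLp (fun ω ↦ X' ω i) 2 P' := (hG.fst.eval i).memLp_two
    have hY : MemLp Y' 2 P' := hG.snd.memLp_two
    have hX''i (i : Fin q) (ω : Ω') : X'' ω i = X' ω i + (ξ - Y' ω) * γ i := by
      rw [hX'']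
      rfl
    refine ⟨tendstoInDistribution_of_tendsto_kernelLaw_map hXt hlaw
      (tendsto_kernelLaw_map_of_stochMonotoneWrt T ha hc frequently_Ici_mem_nhds_real hκ hmono hlim
        hyS hy ?_ (hasCondDistrib_translationKernel hX'm hY'm
          (indepFun_sub_smul_of_hasGaussianLaw hG hv hγ))
        (continuous_kernelLaw_translationKernel ρ γ).continuousAt), ?_, fun i ↦ ?_, fun i j ↦ ?_⟩
    · rw [support_map_eq_univ_of_hasGaussianLaw hG.snd hv]
      simp
    · let L : ((Fin q → ℝ) × ℝ) →L[ℝ] (Fin q → ℝ) :=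
        ContinuousLinearMap.fst ℝ (Fin q → ℝ) ℝ -
          (ContinuousLinearMap.snd ℝ (Fin q → ℝ) ℝ).smulRight γ
      have hρ : IsGaussian ρ := (hG.map_fun L).isGaussian_map
      have : IsGaussian (translationKernel ρ γ ξ) := by
        rw [translationKernel_apply]
        infer_instance
      exact hlaw.hasGaussianLaw
    · have hYint : Integrable Y' P' := hY.integrable one_le_two
      have hint : Integrable (fun ω ↦ (ξ - Y' ω) * γ i) P' :=
        ((integrable_const ξ).sub hYint).mul_const (γ i)
      simp only [hX''i]
      rw [integral_add ((hXi i).integrable one_le_two) hint, integral_mul_const,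
        integral_sub (integrable_const _) hYint]
      simp
    · have hYγ (k : Fin q) : MemLp (fun ω ↦ Y' ω * γ k) 2 P' := hY.mul_const (γ k)
      have hres (k : Fin q) : Integrable (fun ω ↦ X' ω k - Y' ω * γ k) P' :=
        ((hXi k).sub (hYγ k)).integrable one_le_two
      have hsplit (k : Fin q) :
          (fun ω ↦ X'' ω k) = fun ω ↦ (X' ω k - Y' ω * γ k) + ξ * γ k := by
        ext1 ω
        rw [hX''i]
        ring
      rw [hsplit i, hsplit j, covariance_add_const_left (hres i),
        covariance_add_const_right (hres j),
        covariance_fun_sub_fun_sub (hXi i) (hYγ i) (hXi j) (hYγ j), covariance_mul_const_right,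
        covariance_mul_const_left, covariance_mul_const_left, covariance_mul_const_right,
        covariance_self hY.aemeasurable, covariance_comm Y', hγ i, hγ j]
      field_simp
      ring
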